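/- **Definitions.** For $x\in\{0,1\}^r$ let $|x|$ be its Hamming weight. A relation (predicate) $R\subseteq\{0,1\}^r$ is *symmetric* if membership of $x$ in $R$ depends only on $|x|$; it is then determined by its set of accepted weights $W(R)=\{|x| : x\in R\}\subseteq\{0,\dots,r\}$. It is *non-trivial* if $\emptyset\neq R\neq\{0,1\}^r$. Its *bit-flip* is $\overline R=\{1-x : x\in R\}$; for symmetric $R$ one has $W(\overline R)=\{r-w : w\in W(R)\}$. Fix a set $\mathcal U$ of maps $\{0,1\}\to\{0,1\}$ that contains the identity (for example $\{\mathrm{id},\neg,0,1\}$ for literals and constants, or $\{\mathrm{id}\}$ for plain variables). An *$R$-constraint* on the variables $x_1,\dots,x_n$ is a tuple $(g_1(x_{i_1}),\dots,g_r(x_{i_r}))$ with $g_j\in\mathcal U$ and $i_j\in\{1,\dots,n\}$ (repetitions allowed); an assignment $\sigma:\{x_1,\dots,x_n\}\to\{0,1\}$ satisfies it if $(g_1(\sigma(x_{i_1})),\dots,g_r(\sigma(x_{i_r})))\in R$. An *instance* is a set of $R$-constraints. A constraint of an instance is *redundant* if deleting it does not change the set of assignments that satisfy all constraints of the instance; an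 instance is *non-redundant* if none of its constraints is redundant. $\mathrm{NRD}_n(R)$ is the maximum number of constraints of a non-redundant instance on $n$ variables. **Theorem.** Let $R\subseteq\{0,1\}^r$ be a non-trivial symmetric predicate. Asymptotics are for $n\to\infty$, with $r$, $R$ and $\mathcal U$ fixed. 1. If $r\le 4$, then $\mathrm{NRD}_n(R)=\Theta(n^{e})$, where $e$ is the exponent under which $W(R)$ or $W(\overline R)$ is listed for arity $r$: - $r=1$: $e=1$: $\{0\}$. - $r=2$: $e=1$: $\{0\},\{1\},\{0,2\}$; $e=2$: $\{0,1\}$. - $r=3$: $e=1$: $\{0\},\{1\},\{0,2\},\{0,3\}$; $e=2$: $\{0,1\},\{1,2\},\{0,1,3\}$; $e=3$: $\{0,1,2\}$. - $r=4$: $e=1$: $\{0\},\{1\},\{2\},\{0,3\},\{1,3\},\{0,4\},\{0,2,4\}$; $e=2$: $\{0,1\},\{0,2\},\{1,2\},\{0,1,3\},\{0,2,3\},\{0,1,4\},\{0,1,3,4\}$; $e=3$: $\{0,1,2\},\{1,2,3\},\{0,1,2,4\}$; $e=4$: $\{0,1,2,3\}$. 2. If $r=5$ and neither $W(R)$ nor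 $W(\overline R)$ is $\{0,2,3\}$ or $\{1,2,4\}$, then $\mathrm{NRD}_n(R)=\Theta(n^{e})$, where $e$ is the exponent under which $W(R)$ or $W(\overline R)$ is listed here: - $e=1$: $\{0\},\{1\},\{2\},\{0,3\},\{0,4\},\{1,4\},\{0,2,4\},\{0,5\}$; - $e=2$: $\{0,1\},\{0,2\},\{1,2\},\{1,3\},\{0,1,3\},\{2,3\},\{0,1,4\},\{0,3,4\},\{0,1,3,4\},\{0,1,5\},\{0,2,5\},\{0,1,3,5\},\{0,2,3,5\},\{0,1,4,5\}$; - $e=3$: $\{0,1,2\},\{1,2,3\},\{0,1,2,4\},\{0,2,3,4\},\{0,1,2,5\},\{0,1,2,4,5\}$; - $e=4$: $\{0,1,2,3\},\{1,2,3,4\},\{0,1,2,3,5\}$; - $e=5$: $\{0,1,2,3,4\}$. If $r=5$ and $W(R)$ or $W(\overline R)$ is $\{0,2,3\}$ or $\{1,2,4\}$, then $\Omega(n^2)\le\mathrm{NRD}_n(R)\le O(n^3)$. In 1 and 2, exactly one exponent is listed for each such $R$. -/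

import Mathlib

open Filter Asymptotics

namespace BoolCSP

/-- The Hamming weight of a Boolean tuple: the number of coordinates equal to `1`. -/
def hammingWeight {r : ℕ} (x : Fin r → Bool) : ℕ :=
  (Finset.univ.filter fun i => x i = true).card

/-- A Boolean relation is symmetric if membership depends only on the Hamming weight. -/
def IsSymmetric {r : ℕ} (R : Set (Fin r → Bool)) : Prop :=
  ∀ x y : Fin r → Bool, hammingWeight x = hammingWeight y → (x ∈ R ↔ y ∈ R)

/-- A relation is non-trivial if it is neither empty nor the whole cube. -/
def IsNontrivial {r : ℕ} (R : Set (Fin r → Bool)) : Prop :=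
  R ≠ ∅ ∧ R ≠ Set.univ

/-- The set `W(R)` of accepted weights. -/
def acceptedWeights {r : ℕ} (R : Set (Fin r → Bool)) : Set ℕ :=
  hammingWeight '' R

/-- The image of `R` under flipping all bits. -/
def bitFlip {r : ℕ} (R : Set (Fin r → Bool)) : Set (Fin r → Bool) :=
  (fun x i => !(x i)) '' R

/-- An `R`-constraint on `n` variables: the relation is applied to the tuple of literals
`(g₁ (x_{i₁}), …, g_r (x_{i_r}))`, where every `g_j` belongs to the fixed set `U` of unary maps.
Variables may repeat. For `U = {id}` this is the positive model. -/
abbrev Constraint (U : Finset (Bool → Bool)) (r n : ℕ) : Type :=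
  Fin r → U × Fin n

/-- The Boolean tuple that an assignment induces on a constraint. -/
def Constraint.eval {U : Finset (Bool → Bool)} {r n : ℕ} (C : Constraint U r n)
    (σ : Fin n → Bool) : Fin r → Bool :=
  fun j => (C j).1.1 (σ (C j).2)

/-- The set of satisfying assignments of an instance, a finite set of `R`-constraints. -/
def Sat {U : Finset (Bool → Bool)} {r n : ℕ} (R : Set (Fin r → Bool))
    (I : Finset (Constraint U r n)) : Set (Fin n → Bool) :=
  {σ | ∀ C ∈ I, Constraint.eval C σ ∈ R}

/-- A constraint is redundant if deleting it keeps the set of satisfying assignments. -/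
def IsRedundant {U : Finset (Bool → Bool)} {r n : ℕ} (R : Set (Fin r → Bool))
    (I : Finset (Constraint U r n)) (C : Constraint U r n) : Prop :=
  Sat R (I.erase C) = Sat R I

/-- An instance is non-redundant if none of its constraints is redundant. -/
def IsNonRedundant {U : Finset (Bool → Bool)} {r n : ℕ} (R : Set (Fin r → Bool))
    (I : Finset (Constraint U r n)) : Prop :=
  ∀ C ∈ I, ¬ IsRedundant R I C

/-- `NRD_n(R)`: the maximum number of constraints of a non-redundant instance of `CSP(R)` on `n`
variables. -/
noncomputable def NRD (U : Finset (Bool → Bool)) {r : ℕ} (R : Set (Fin r → Bool)) (n : ℕ) : ℕ :=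
  sSup {m | ∃ I : Finset (Constraint U r n), IsNonRedundant R I ∧ I.card = m}

/-- The supremum that defines `NRD` is an attained maximum. -/
theorem isGreatest_NRD (U : Finset (Bool → Bool)) {r : ℕ} (R : Set (Fin r → Bool)) (n : ℕ) :
    IsGreatest {m | ∃ I : Finset (Constraint U r n), IsNonRedundant R I ∧ I.card = m}
      (NRD U R n) := by
  have hb : BddAbove {m | ∃ I : Finset (Constraint U r n), IsNonRedundant R I ∧ I.card = m} := by
    refine ⟨Fintype.card (Constraint U r n), ?_⟩
    rintro m ⟨I, -, rfl⟩
    exact Finset.card_le_univ I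
  have hne : {m | ∃ I : Finset (Constraint U r n), IsNonRedundant R I ∧ I.card = m}.Nonempty :=
    ⟨0, ∅, fun C hC => absurd hC (Finset.notMem_empty C), Finset.card_empty⟩
  exact ⟨Nat.sSup_mem hne hb, fun m hm => le_csSup hb hm⟩

/-- The table of growth exponents. For arity `r`, each row is an accepted-weight set together
with the exponent of the corresponding symmetric predicate; one predicate is listed from every
pair related by the bit-flip, and the two unresolved predicates of arity `5` are left out. -/
def exponentTable : ℕ → List (Finset ℕ × ℕ)
  | 1 => [({0}, 1)]
  | 2 => [({0}, 1), ({1}, 1), ({0, 1}, 2), ({0, 2}, 1)]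
  | 3 => [({0}, 1), ({1}, 1), ({0, 1}, 2), ({0, 2}, 1), ({1, 2}, 2), ({0, 1, 2}, 3),
      ({0, 3}, 1), ({0, 1, 3}, 2)]
  | 4 => [({0}, 1), ({1}, 1), ({0, 1}, 2), ({2}, 1), ({0, 2}, 2), ({1, 2}, 2), ({0, 1, 2}, 3),
      ({0, 3}, 1), ({1, 3}, 1), ({0, 1, 3}, 2), ({0, 2, 3}, 2), ({1, 2, 3}, 3),
      ({0, 1, 2, 3}, 4), ({0, 4}, 1), ({0, 1, 4}, 2), ({0, 2, 4}, 1), ({0, 1, 2, 4}, 3),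
      ({0, 1, 3, 4}, 2)]
  | 5 => [({0}, 1), ({1}, 1), ({0, 1}, 2), ({2}, 1), ({0, 2}, 2), ({1, 2}, 2), ({0, 1, 2}, 3),
      ({0, 3}, 1), ({1, 3}, 2), ({0, 1, 3}, 2), ({2, 3}, 2), ({1, 2, 3}, 3),
      ({0, 1, 2, 3}, 4), ({0, 4}, 1), ({1, 4}, 1), ({0, 1, 4}, 2), ({0, 2, 4}, 1),
      ({0, 1, 2, 4}, 3), ({0, 3, 4}, 2), ({0, 1, 3, 4}, 2), ({0, 2, 3, 4}, 3),
      ({1, 2, 3, 4}, 4), ({0, 1, 2, 3, 4}, 5), ({0, 5}, 1), ({0, 1, 5}, 2), ({0, 2, 5}, 2),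
      ({0, 1, 2, 5}, 3), ({0, 1, 3, 5}, 2), ({0, 2, 3, 5}, 2), ({0, 1, 2, 3, 5}, 4),
      ({0, 1, 4, 5}, 2), ({0, 1, 2, 4, 5}, 3)]
  | _ => []

/-- `R` has weight set `W` up to the bit-flip. -/
def HasWeightsUpToFlip {r : ℕ} (R : Set (Fin r → Bool)) (W : Finset ℕ) : Prop :=
  acceptedWeights R = (W : Set ℕ) ∨ acceptedWeights (bitFlip R) = (W : Set ℕ)

/-- The table lists, up to the bit-flip, the predicate `R` with exponent `e`. -/
def IsTableExponent {r : ℕ} (R : Set (Fin r → Bool)) (e : ℕ) : Prop :=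
  ∃ W : Finset ℕ, (W, e) ∈ exponentTable r ∧ HasWeightsUpToFlip R W

/-- The two predicates of arity `5` whose exponent is not determined, up to the bit-flip. -/
def IsExceptional (R : Set (Fin 5 → Bool)) : Prop :=
  HasWeightsUpToFlip R {0, 2, 3} ∨ HasWeightsUpToFlip R {1, 2, 4}

end BoolCSP

namespace BoolCSP

/-! Upper bounds use polynomials over `ZMod m`. Suppose each `y ∉ R` has a polynomial of degree at
most `d` that vanishes on `R` but not at `y`. In a non-redundant instance every constraint `C` has a
witness violating `C` alone. Among the constraints whose witnesses produce the same violated tuple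
`y`, composing the polynomial of `y` with each constraint gives functions that are nonzero at their
own witness and zero at the others. Their subset sums are distinct functions of degree at most `d`,
so there are O(n^d) of them, and there are at most `2 ^ r` tuples `y`.

Lower bounds restrict `R` to `e` blocks of equal coordinates plus constants. If only the all-true
block pattern is rejected, one constraint for each choice of a variable per block gives a
non-redundant instance of order n^e.

For symmetric `R` both criteria become finite arithmetic on weights, so a kernel computation checks
the table: `exists_separatesWeights`, `exists_omitsLast` and `exponentTable_complete`. -/

/-! ### Polynomial functions on the cube -/

section Polynomial

variable (A : Type*) [CommRing A]

/-- The coordinate functions on the cube with values in `A`, together with the constant `1`. -/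
def coordinate {n : ℕ} : Option (Fin n) → (Fin n → Bool) → A
  | none => 1
  | some i => fun x => if x i then 1 else 0

/-- The `A`-valued functions on the cube that are affine in the coordinates. -/
def affineFun (n : ℕ) : Submodule A ((Fin n → Bool) → A) :=
  Submodule.span A (Set.range (coordinate A))

/-- The `A`-valued functions on the cube given by polynomials of degree at most `d`. -/
def polyFun (n d : ℕ) : Submodule A ((Fin n → Bool) → A) :=
  affineFun A n ^ d

variable {A}

theorem one_mem_affineFun (n : ℕ) : (1 : (Fin n → Bool) → A) ∈ affineFun A n :=
  Submodule.subset_span ⟨none, rfl⟩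

theorem coordinate_mem_affineFun {n : ℕ} (i : Option (Fin n)) :
    coordinate A i ∈ affineFun A n :=
  Submodule.subset_span ⟨i, rfl⟩

theorem polyFun_mono (n : ℕ) {d e : ℕ} (h : d ≤ e) : polyFun A n d ≤ polyFun A n e :=
  pow_le_pow_right' (Submodule.one_le.mpr (one_mem_affineFun n)) h

theorem literal_mem_affineFun {n : ℕ} (g : Bool → Bool) (i : Fin n) :
    (fun σ : Fin n → Bool => if g (σ i) then (1 : A) else 0) ∈ affineFun A n := by
  have h : (fun σ : Fin n → Bool => if g (σ i) then (1 : A) else 0) =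
      (if g false then (1 : A) else 0) • coordinate A none +
      ((if g true then (1 : A) else 0) - (if g false then (1 : A) else 0)) •
        coordinate A (some i) := by
    funext σ
    simp only [Pi.add_apply, Pi.smul_apply, smul_eq_mul, coordinate, Pi.one_apply]
    cases σ i <;> simp
  rw [h]
  exact Submodule.add_mem _ (Submodule.smul_mem _ _ (coordinate_mem_affineFun _))
    (Submodule.smul_mem _ _ (coordinate_mem_affineFun _))

theorem comp_mem_polyFun {n r d : ℕ} {φ : (Fin n → Bool) → Fin r → Bool}
    (hφ : ∀ j, (fun σ => if φ σ j then (1 : A) else 0) ∈ affineFun A n)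
    {f : (Fin r → Bool) → A} (hf : f ∈ polyFun A r d) :
    (fun σ => f (φ σ)) ∈ polyFun A n d := by
  let F : ((Fin r → Bool) → A) →ₐ[A] ((Fin n → Bool) → A) :=
    { toFun := fun f σ => f (φ σ)
      map_one' := rfl
      map_mul' := fun _ _ => rfl
      map_zero' := rfl
      map_add' := fun _ _ => rfl
      commutes' := fun _ => rfl }
  have hF : (affineFun A r).map F.toLinearMap ≤ affineFun A n := by
    rw [affineFun, Submodule.map_span, Submodule.span_le]
    rintro _ ⟨_, ⟨j, rfl⟩, rfl⟩
    cases j with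
    | none => exact one_mem_affineFun n
    | some j => exact hφ j
  have h : (polyFun A r d).map F.toLinearMap ≤ polyFun A n d := by
    rw [polyFun, Submodule.map_pow]
    exact pow_le_pow_left' hF d
  exact h ⟨f, hf, rfl⟩

theorem prod_coordinate_mem_polyFun {n : ℕ} (s : Finset (Fin n)) :
    ∏ i ∈ s, coordinate A (some i) ∈ polyFun A n s.card := by
  classical
  induction s using Finset.induction_on with
  | empty => exact Submodule.one_le.mp (by simp [polyFun])
  | insert i s hi ih =>
    rw [Finset.prod_insert hi, Finset.card_insert_of_notMem hi, polyFun, pow_succ']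
    exact Submodule.mul_mem_mul (coordinate_mem_affineFun _) ih

/-- The binomial coefficient counts `k`-subsets of the support, so it is the elementary symmetric
polynomial of degree `k`. No division by `k!` occurs, which matters modulo a general `m`. -/
theorem choose_hammingWeight_mem_polyFun (n k : ℕ) :
    (fun x : Fin n → Bool => ((hammingWeight x).choose k : A)) ∈ polyFun A n k := by
  have h : (fun x : Fin n → Bool => ((hammingWeight x).choose k : A)) =
      ∑ s ∈ Finset.powersetCard k Finset.univ, ∏ i ∈ s, coordinate A (some i) := by
    funext x
    have hs : ∀ s : Finset (Fin n), (∏ i ∈ s, coordinate A (some i)) x =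
        if s ⊆ Finset.univ.filter (fun i => x i = true) then (1 : A) else 0 := by
      intro s
      rw [Finset.prod_apply]
      simp only [coordinate]
      rw [Finset.prod_ite_zero]
      simp [Finset.subset_iff]
    rw [Finset.sum_apply, Finset.sum_congr rfl fun s _ => hs s, Finset.sum_boole, hammingWeight,
      ← Finset.card_powersetCard]
    congr 2
    ext s
    simp only [Finset.mem_powersetCard, Finset.mem_filter, Finset.subset_univ, true_and]
    exact and_comm
  rw [h]
  refine Submodule.sum_mem _ fun s hs => ?_
  rw [← (Finset.mem_powersetCard.mp hs).2]
  exact prod_coordinate_mem_polyFun s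

/-- A non-symmetric quadratic for weight sets that binomials cannot handle. For {0, 1, 3, 5}, a
degree-2 combination of binomials vanishing there must be zero, while this function modulo 2
vanishes there and is nonzero at even positive weights when `x i` holds. -/
theorem coordinate_mul_hammingWeight_mem_polyFun {n : ℕ} (i : Fin n) :
    (fun x : Fin n → Bool => (if x i then (1 : A) else 0) * (hammingWeight x + 1)) ∈
      polyFun A n 2 := by
  rw [polyFun, pow_two]
  refine Submodule.mul_mem_mul (coordinate_mem_affineFun (some i)) ?_
  refine Submodule.add_mem _ ?_ (one_mem_affineFun n)
  simpa [polyFun] using choose_hammingWeight_mem_polyFun (A := A) n 1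

end Polynomial

open scoped Pointwise in
theorem card_polyFun_le (m : ℕ) [NeZero m] (n d : ℕ) :
    Nat.card (polyFun (ZMod m) n d) ≤ m ^ (n + 1) ^ d := by
  classical
  let S : Finset ((Fin n → Bool) → ZMod m) := Finset.univ.image (coordinate (ZMod m))
  have hS : S.card ≤ n + 1 := by
    simpa using (Finset.card_image_le (s := Finset.univ) (f := coordinate (ZMod m) (n := n)))
  let T := S ^ d
  have hT : T.card ≤ (n + 1) ^ d := Finset.card_pow_le.trans (Nat.pow_le_pow_left hS d)
  have hspan : polyFun (ZMod m) n d = Submodule.span (ZMod m) (T : Set _) := by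
    rw [polyFun, affineFun, Submodule.span_pow, Finset.coe_pow, Finset.coe_image, Finset.coe_univ,
      Set.image_univ]
  have hr : LinearMap.range (Fintype.linearCombination (ZMod m) (Subtype.val : T → _)) =
      polyFun (ZMod m) n d := by
    rw [hspan, Fintype.range_linearCombination, Subtype.range_coe]
  rw [← hr]
  calc Nat.card _ ≤ Nat.card (T → ZMod m) :=
        Nat.card_le_card_of_surjective _ (LinearMap.surjective_rangeRestrict _)
    _ = m ^ T.card := by simp
    _ ≤ _ := Nat.pow_le_pow_right (NeZero.pos m) hT

/-- The diagonal values may be zero divisors, so linear independence can fail. Sums with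
coefficients 0 and 1 remain distinct, and counting them replaces a dimension bound. -/
theorem two_pow_card_le_of_diagonal {ι X A : Type*} [Fintype ι] [CommRing A]
    (V : Submodule A (X → A)) [Finite V] (f : ι → X → A) (hf : ∀ i, f i ∈ V) (σ : ι → X)
    (hdiag : ∀ i, f i (σ i) ≠ 0) (hoff : ∀ i j, i ≠ j → f i (σ j) = 0) :
    2 ^ Fintype.card ι ≤ Nat.card V := by
  classical
  have heval : ∀ (J : Finset ι) (j : ι),
      (∑ i ∈ J, f i) (σ j) = if j ∈ J then f j (σ j) else 0 := by
    intro J j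
    rw [Finset.sum_apply, ← Finset.sum_ite_eq' J j fun i => f i (σ j)]
    refine Finset.sum_congr rfl fun i _ => ?_
    split_ifs with h
    · rfl
    · exact hoff i j h
  have hinj : Function.Injective
      fun J : Finset ι => (⟨∑ i ∈ J, f i, Submodule.sum_mem _ fun i _ => hf i⟩ : V) := by
    intro J K h
    have h' : ∑ i ∈ J, f i = ∑ i ∈ K, f i := congrArg Subtype.val h
    ext j
    have hj := congrFun h' (σ j)
    rw [heval, heval] at hj
    have := hdiag j
    by_cases h1 : j ∈ J <;> by_cases h2 : j ∈ K <;> simp_all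
  have := Nat.card_le_card_of_injective _ hinj
  simpa [Nat.card_eq_fintype_card] using this

/-! ### Non-redundant instances -/

section Instances

variable {U : Finset (Bool → Bool)} {r n : ℕ} {R : Set (Fin r → Bool)}

theorem isRedundant_iff {I : Finset (Constraint U r n)} {C : Constraint U r n} :
    IsRedundant R I C ↔
      ∀ σ : Fin n → Bool, (∀ D ∈ I, D ≠ C → D.eval σ ∈ R) → C ∈ I → C.eval σ ∈ R := by
  constructor
  · intro h σ hσ hC
    have hmem : σ ∈ Sat R I := by
      rw [← h]
      exact fun D hD => hσ D (Finset.mem_of_mem_erase hD) (Finset.ne_of_mem_erase hD)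
    exact hmem C hC
  · intro h
    ext σ
    constructor
    · intro hσ D hD
      by_cases hDC : D = C
      · subst hDC
        exact h σ (fun E hE hne => hσ E (Finset.mem_erase.mpr ⟨hne, hE⟩)) hD
      · exact hσ D (Finset.mem_erase.mpr ⟨hDC, hD⟩)
    · exact fun hσ D hD => hσ D (Finset.mem_of_mem_erase hD)

theorem IsNonRedundant.exists_witness {I : Finset (Constraint U r n)} (hI : IsNonRedundant R I)
    {C : Constraint U r n} (hC : C ∈ I) :
    ∃ σ : Fin n → Bool, (∀ D ∈ I, D ≠ C → D.eval σ ∈ R) ∧ C.eval σ ∉ R := by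
  have h := hI C hC
  rw [isRedundant_iff] at h
  push Not at h
  obtain ⟨σ, h1, -, h2⟩ := h
  exact ⟨σ, h1, h2⟩

theorem card_le_NRD {I : Finset (Constraint U r n)} (hI : IsNonRedundant R I) :
    I.card ≤ NRD U R n :=
  (isGreatest_NRD U R n).2 ⟨I, hI, rfl⟩

/-! ### Upper bounds from separating polynomials -/

/-- Every tuple outside `R` is separated from `R` by a polynomial of degree at most `d` over
`ZMod m`. -/
def IsSeparated (R : Set (Fin r → Bool)) (m d : ℕ) : Prop :=
  ∀ y ∉ R, ∃ f ∈ polyFun (ZMod m) r d, (∀ x ∈ R, f x = 0) ∧ f y ≠ 0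

theorem IsSeparated.of_bitFlip {m d : ℕ} (h : IsSeparated (bitFlip R) m d) :
    IsSeparated R m d := by
  intro y hy
  have hy' : (fun i => !(y i)) ∉ bitFlip R := by
    rintro ⟨z, hz, hzy⟩
    have : z = y := by
      funext i
      simpa using congrFun hzy i
    exact hy (this ▸ hz)
  obtain ⟨f, hf, h0, h1⟩ := h _ hy'
  refine ⟨fun x => f fun i => !(x i), comp_mem_polyFun (fun j => ?_) hf,
    fun x hx => h0 _ ⟨x, hx, rfl⟩, h1⟩
  exact literal_mem_affineFun not j

theorem card_le_of_isSeparated {m d : ℕ} [NeZero m] (h : IsSeparated R m d)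
    {I : Finset (Constraint U r n)} (hI : IsNonRedundant R I) :
    I.card ≤ m * (n + 1) ^ d * 2 ^ r := by
  classical
  choose! σ hσ hσ' using fun C (hC : C ∈ I) => hI.exists_witness hC
  let v : Constraint U r n → Fin r → Bool := fun C => C.eval (σ C)
  have hfib : ∀ y ∈ I.image v, (I.filter fun C => v C = y).card ≤ m * (n + 1) ^ d := by
    intro y hy
    obtain ⟨C₀, hC₀, rfl⟩ := Finset.mem_image.mp hy
    obtain ⟨f, hf, h0, h1⟩ := h _ (hσ' C₀ hC₀)
    set J := I.filter fun C => v C = v C₀ with hJ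
    have hmem : ∀ C : J, C.1 ∈ I ∧ v C.1 = v C₀ := fun C => Finset.mem_filter.mp C.2
    have hcard := two_pow_card_le_of_diagonal (polyFun (ZMod m) n d)
      (fun (C : J) τ => f (C.1.eval τ))
      (fun C => comp_mem_polyFun (fun j => literal_mem_affineFun (C.1 j).1.1 (C.1 j).2) hf)
      (fun C => σ C.1)
      (fun C => by
        have : C.1.eval (σ C.1) = v C₀ := (hmem C).2
        rwa [this])
      -- The witness of `D` satisfies every other constraint, and `f` vanishes on `R`.
      (fun C D hCD => h0 _ (hσ D.1 (hmem D).1 C.1 (hmem C).1 fun h => hCD (Subtype.ext h)))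
    rw [Fintype.card_coe] at hcard
    -- Uses `m ≤ 2 ^ m` to turn the base `m` into 2.
    have hpow : 2 ^ J.card ≤ 2 ^ (m * (n + 1) ^ d) := by
      refine (hcard.trans (card_polyFun_le m n d)).trans ?_
      rw [pow_mul]
      exact Nat.pow_le_pow_left Nat.lt_two_pow_self.le _
    exact (Nat.pow_le_pow_iff_right one_lt_two).mp hpow
  refine (Finset.card_le_mul_card_image I _ hfib).trans (Nat.mul_le_mul_left _ ?_)
  exact (Finset.card_le_univ _).trans (by simp)

theorem IsSeparated.isBigO {m d : ℕ} [NeZero m] (h : IsSeparated R m d) :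
    (fun n : ℕ => (NRD U R n : ℝ)) =O[atTop] fun n : ℕ => (n : ℝ) ^ d := by
  refine IsBigO.of_bound ((m * 2 ^ d * 2 ^ r : ℕ) : ℝ) ?_
  filter_upwards [eventually_ge_atTop 1] with n hn
  obtain ⟨I, hI, hcard⟩ := (isGreatest_NRD U R n).1
  have h1 : NRD U R n ≤ m * 2 ^ d * 2 ^ r * n ^ d := by
    rw [← hcard]
    refine (card_le_of_isSeparated h hI).trans ?_
    have : (n + 1) ^ d ≤ 2 ^ d * n ^ d := by
      rw [← mul_pow]
      exact Nat.pow_le_pow_left (by omega) d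
    calc m * (n + 1) ^ d * 2 ^ r ≤ m * (2 ^ d * n ^ d) * 2 ^ r := by gcongr
      _ = _ := by ring
  rw [Real.norm_of_nonneg (by positivity), Real.norm_of_nonneg (by positivity)]
  exact_mod_cast h1

/-! ### Lower bounds from templates -/

/-- The tuple obtained from a template whose coordinates are block indices or constants. -/
def substitute {e : ℕ} (g : Fin r → Fin e ⊕ Bool) (s : Fin e → Bool) : Fin r → Bool :=
  fun j => Sum.elim s id (g j)

theorem pow_le_NRD_of_template {e q : ℕ} (hU : id ∈ U) (g : Fin r → Fin e ⊕ Bool)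
    (φ : Bool → Bool)
    (hg : ∀ s : Fin e → Bool, (fun j => φ (substitute g s j)) ∈ R ↔ ∃ k, s k = false)
    (hn : e * q + 2 ≤ n) : q ^ e ≤ NRD U R n := by
  classical
  -- Two spare variables play the constants, so only `id ∈ U` is needed.
  obtain ⟨ψ⟩ : Nonempty ((Fin e × Fin q) ⊕ Bool ↪ Fin n) :=
    Function.Embedding.nonempty_of_card_le (by simpa using hn)
  let C : (Fin e → Fin q) → Constraint U r n := fun t j =>
    (⟨id, hU⟩, ψ (Sum.map (fun k => (k, t k)) id (g j)))
  -- Up to `φ`, `σ u` marks the variable chosen by `u` in each block. Hence `C t` sees block `k` as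
  -- true exactly when `u k = t k`, and it fails only for `u = t`.
  let σ : (Fin e → Fin q) → Fin n → Bool := fun t =>
    Function.extend ψ (fun a => φ (Sum.elim (fun p => decide (t p.1 = p.2)) id a)) fun _ => false
  have heval : ∀ t u, (C t).eval (σ u) =
      fun j => φ (substitute g (fun k => decide (u k = t k)) j) := by
    intro t u
    funext j
    simp only [Constraint.eval, C, σ, id, substitute]
    rw [ψ.injective.extend_apply]
    cases g j <;> rfl
  have hmem : ∀ t u, (C t).eval (σ u) ∈ R ↔ u ≠ t := by
    intro t u
    rw [heval, hg, Function.ne_iff]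
    simp
  have hinj : Function.Injective C := by
    intro t u h
    by_contra hne
    have := (hmem u t).mpr hne
    rw [← h, hmem] at this
    exact this rfl
  have hI : IsNonRedundant R (Finset.univ.image C) := by
    intro D hD
    obtain ⟨t, -, rfl⟩ := Finset.mem_image.mp hD
    rw [isRedundant_iff]
    intro h
    refine (hmem t t).mp (h (σ t) ?_ hD) rfl
    intro E hE hne
    obtain ⟨u, -, rfl⟩ := Finset.mem_image.mp hE
    exact (hmem u t).mpr fun h => hne (h ▸ rfl)
  have := card_le_NRD hI
  rwa [Finset.card_image_of_injective _ hinj, Finset.card_univ, Fintype.card_fun,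
    Fintype.card_fin, Fintype.card_fin] at this

theorem isBigO_NRD_of_template {e : ℕ} (hU : id ∈ U) (g : Fin r → Fin e ⊕ Bool)
    (φ : Bool → Bool)
    (hg : ∀ s : Fin e → Bool, (fun j => φ (substitute g s j)) ∈ R ↔ ∃ k, s k = false) :
    (fun n : ℕ => (n : ℝ) ^ e) =O[atTop] fun n : ℕ => (NRD U R n : ℝ) := by
  refine IsBigO.of_bound (((2 * e + 2) ^ e : ℕ) : ℝ) ?_
  filter_upwards [eventually_ge_atTop (e + 2)] with n hn
  have h1 : n ^ e ≤ (2 * e + 2) ^ e * NRD U R n := by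
    rcases Nat.eq_zero_or_pos e with rfl | he
    · simpa using pow_le_NRD_of_template (q := 0) (n := n) hU g φ hg (by omega)
    · have hdiv := Nat.div_add_mod (n - 2) e
      have hmod := Nat.mod_lt (n - 2) he
      have hq : 1 ≤ (n - 2) / e := (Nat.one_le_div_iff he).mpr (by omega)
      generalize (n - 2) / e = q at *
      have hle : n ≤ (2 * e + 2) * q := by nlinarith [Nat.sub_add_cancel (show 2 ≤ n by omega)]
      calc n ^ e ≤ ((2 * e + 2) * q) ^ e := Nat.pow_le_pow_left hle e
        _ = (2 * e + 2) ^ e * q ^ e := mul_pow _ _ _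
        _ ≤ _ := Nat.mul_le_mul_left _ (pow_le_NRD_of_template hU g φ hg (by omega))
  rw [Real.norm_of_nonneg (by positivity), Real.norm_of_nonneg (by positivity)]
  exact_mod_cast h1

end Instances

/-! ### Symmetric relations -/

section Symmetric

variable {r : ℕ} {R : Set (Fin r → Bool)}

theorem hammingWeight_eq_sum (x : Fin r → Bool) :
    hammingWeight x = ∑ i, if x i = true then 1 else 0 :=
  Finset.card_filter _ _

theorem hammingWeight_le (x : Fin r → Bool) : hammingWeight x ≤ r :=
  (Finset.card_filter_le _ _).trans (by simp)

theorem hammingWeight_not (x : Fin r → Bool) :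
    hammingWeight (fun i => !(x i)) = r - hammingWeight x := by
  have h := Finset.card_filter_add_card_filter_not (s := Finset.univ) fun i => x i = true
  simp only [Finset.card_univ, Fintype.card_fin, Bool.not_eq_true] at h
  simp only [hammingWeight, Bool.not_eq_true']
  omega

theorem mem_bitFlip {x : Fin r → Bool} : x ∈ bitFlip R ↔ (fun i => !(x i)) ∈ R := by
  constructor
  · rintro ⟨y, hy, rfl⟩
    simpa using hy
  · exact fun h => ⟨_, h, by simp⟩

theorem IsSymmetric.bitFlip (hR : IsSymmetric R) : IsSymmetric (bitFlip R) := by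
  intro x y h
  rw [mem_bitFlip, mem_bitFlip]
  exact hR _ _ (by rw [hammingWeight_not, hammingWeight_not, h])

theorem IsSymmetric.mem_iff (hR : IsSymmetric R) {x : Fin r → Bool} :
    x ∈ R ↔ hammingWeight x ∈ acceptedWeights R :=
  ⟨fun h => ⟨x, h, rfl⟩, fun ⟨y, hy, h⟩ => (hR y x h).mp hy⟩

theorem acceptedWeights_bitFlip :
    acceptedWeights (bitFlip R) = (fun w => r - w) '' acceptedWeights R := by
  simp only [acceptedWeights, BoolCSP.bitFlip, Set.image_image, hammingWeight_not]

/-- The value at `v` of the integer-valued polynomial with coefficients `c` in the binomial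
basis. -/
def binomialEval (c : List ℕ) (v : ℕ) : ℕ :=
  ∑ k ∈ Finset.range c.length, c.getD k 0 * v.choose k

theorem binomialEval_hammingWeight_mem_polyFun {m d : ℕ} {c : List ℕ} (hc : c.length ≤ d + 1) :
    (fun x : Fin r → Bool => (binomialEval c (hammingWeight x) : ZMod m)) ∈
      polyFun (ZMod m) r d := by
  have h : (fun x : Fin r → Bool => (binomialEval c (hammingWeight x) : ZMod m)) =
      ∑ k ∈ Finset.range c.length, ((c.getD k 0 : ℕ) : ZMod m) •
        fun x : Fin r → Bool => ((hammingWeight x).choose k : ZMod m) := by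
    funext x
    simp [binomialEval, Finset.sum_apply]
  rw [h]
  refine Submodule.sum_mem _ fun k hk => Submodule.smul_mem _ _ ?_
  exact polyFun_mono r (by have := Finset.mem_range.mp hk; omega)
    (choose_hammingWeight_mem_polyFun r k)

/-- The polynomial `c` of degree at most `d` vanishes modulo `m` on the weights in `W`, and each
other weight `w ≤ r` is separated from `W` by `c` or by a multiple of `xᵢ (|x| + 1)`. -/
def SeparatesWeights (r : ℕ) (W : Finset ℕ) (d m : ℕ) (c : List ℕ) : Prop :=
  m ≠ 0 ∧ c.length ≤ d + 1 ∧ (∀ v ∈ W, m ∣ binomialEval c v) ∧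
    ∀ w ∈ Finset.range (r + 1), w ∉ W → ¬ m ∣ binomialEval c w ∨
      2 ≤ d ∧ w ≠ 0 ∧ ∃ h ∈ Finset.range m, (∀ v ∈ W, v = 0 ∨ m ∣ h * (v + 1)) ∧
        ¬ m ∣ h * (w + 1)

instance (r : ℕ) (W : Finset ℕ) (d m : ℕ) (c : List ℕ) :
    Decidable (SeparatesWeights r W d m c) := by
  unfold SeparatesWeights
  infer_instance

theorem SeparatesWeights.isSeparated {W : Finset ℕ} {d m : ℕ} {c : List ℕ}
    (h : SeparatesWeights r W d m c) (hR : IsSymmetric R) (hW : acceptedWeights R = W) :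
    IsSeparated R m d := by
  obtain ⟨-, hc, hvan, hsep⟩ := h
  have hmem : ∀ x, x ∈ R ↔ hammingWeight x ∈ W := fun x => by
    rw [hR.mem_iff, hW, Finset.mem_coe]
  intro y hy
  rcases hsep (hammingWeight y) (Finset.mem_range_succ_iff.mpr (hammingWeight_le y))
    (fun h => hy ((hmem y).mpr h)) with h | ⟨hd, hw, a, -, hvan', hne⟩
  · refine ⟨_, binomialEval_hammingWeight_mem_polyFun hc, fun x hx => ?_, ?_⟩
    · exact (ZMod.natCast_eq_zero_iff _ _).mpr (hvan _ ((hmem x).mp hx))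
    · exact fun h0 => h ((ZMod.natCast_eq_zero_iff _ _).mp h0)
  · obtain ⟨i, hi⟩ : ∃ i, y i = true := by
      obtain ⟨i, hi⟩ := Finset.card_pos.mp (Nat.pos_of_ne_zero hw)
      exact ⟨i, (Finset.mem_filter.mp hi).2⟩
    refine ⟨_, Submodule.smul_mem _ (a : ZMod m) (polyFun_mono r hd
      (coordinate_mul_hammingWeight_mem_polyFun i)), fun x hx => ?_, ?_⟩
    · simp only [Pi.smul_apply, smul_eq_mul]
      split_ifs with hxi
      · rcases hvan' _ ((hmem x).mp hx) with h0 | h0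
        · exact absurd hxi (Finset.filter_eq_empty_iff.mp (Finset.card_eq_zero.mp h0)
            (Finset.mem_univ i))
        · rw [one_mul]
          exact_mod_cast (ZMod.natCast_eq_zero_iff _ _).mpr h0
      · ring
    · simp only [Pi.smul_apply, smul_eq_mul, hi, if_true, one_mul]
      exact_mod_cast fun h0 => hne ((ZMod.natCast_eq_zero_iff _ _).mp h0)

theorem SeparatesWeights.isBigO {U : Finset (Bool → Bool)} {W : Finset ℕ} {d m : ℕ} {c : List ℕ}
    (h : SeparatesWeights r W d m c) (hR : IsSymmetric R) (hW : HasWeightsUpToFlip R W) :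
    (fun n : ℕ => (NRD U R n : ℝ)) =O[atTop] fun n : ℕ => (n : ℝ) ^ d := by
  have : NeZero m := ⟨h.1⟩
  rcases hW with hW | hW
  · exact (h.isSeparated hR hW).isBigO
  · exact (h.isSeparated hR.bitFlip hW).of_bitFlip.isBigO

/-- Use `a` coordinates for each of the `e` blocks, `b` constant ones, and zeros elsewhere. -/
theorem exists_template {e a b : ℕ} (h : a * e + b ≤ r) :
    ∃ g : Fin r → Fin e ⊕ Bool, ∀ s : Fin e → Bool,
      hammingWeight (substitute g s) = b + a * hammingWeight s := by
  obtain ⟨ε⟩ : Nonempty (Fin r ≃ (Fin a × Fin e) ⊕ Fin b ⊕ Fin (r - (a * e + b))) := by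
    rw [← Fintype.card_eq]
    simp only [Fintype.card_fin, Fintype.card_sum, Fintype.card_prod]
    omega
  refine ⟨fun j => Sum.elim (fun p => Sum.inl p.2)
    (Sum.elim (fun _ => Sum.inr true) fun _ => Sum.inr false) (ε j), fun s => ?_⟩
  rw [hammingWeight_eq_sum, hammingWeight_eq_sum]
  refine (ε.sum_comp fun p => if Sum.elim s id (Sum.elim (fun p : Fin a × Fin e => Sum.inl p.2)
    (Sum.elim (fun _ => Sum.inr true) fun _ => Sum.inr false) p) = true then 1 else 0).trans ?_
  rw [Fintype.sum_sum_type, Fintype.sum_sum_type, Fintype.sum_prod_type]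
  change (∑ _ : Fin a, ∑ k, if s k = true then 1 else 0) +
    ((∑ _ : Fin b, if true = true then 1 else 0) +
      ∑ _ : Fin (r - (a * e + b)), if false = true then 1 else 0) = _
  simp [add_comm]

/-- Among the weights `b + a * s` with `s ≤ e`, exactly `b + a * e` is missing from `W`. -/
def OmitsLast (r : ℕ) (W : Finset ℕ) (e a b : ℕ) : Prop :=
  a * e + b ≤ r ∧ ∀ s ∈ Finset.range (e + 1), b + a * s ∈ W ↔ s ≠ e

instance (r : ℕ) (W : Finset ℕ) (e a b : ℕ) : Decidable (OmitsLast r W e a b) := by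
  unfold OmitsLast
  infer_instance

theorem OmitsLast.isBigO {U : Finset (Bool → Bool)} (hU : id ∈ U) {W : Finset ℕ} {e a b : ℕ}
    (h : OmitsLast r W e a b) (hR : IsSymmetric R) (hW : HasWeightsUpToFlip R W) :
    (fun n : ℕ => (n : ℝ) ^ e) =O[atTop] fun n : ℕ => (NRD U R n : ℝ) := by
  obtain ⟨g, hg⟩ := exists_template h.1
  have hs : ∀ s : Fin e → Bool, b + a * hammingWeight s ∈ W ↔ ∃ k, s k = false := by
    intro s
    rw [h.2 _ (Finset.mem_range_succ_iff.mpr (hammingWeight_le s)), ← not_iff_not]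
    have := Finset.card_filter_eq_iff (s := Finset.univ) (p := fun k => s k = true)
    simpa [hammingWeight] using this
  rcases hW with hW | hW
  · refine isBigO_NRD_of_template hU g id fun s => ?_
    change substitute g s ∈ R ↔ _
    rw [hR.mem_iff, hW, hg, Finset.mem_coe, hs]
  · refine isBigO_NRD_of_template hU g not fun s => ?_
    rw [← mem_bitFlip, hR.bitFlip.mem_iff, hW, hg, Finset.mem_coe, hs]

end Symmetric

/-! ### The table -/

/-- Moduli and polynomials in the binomial basis that separate the weight sets of the table. -/
def separatingPolynomials : List (ℕ × List ℕ) :=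
  [(2, []), (2, [0, 1]), (2, [1, 1]), (3, [0, 1]), (3, [1, 1]), (3, [2, 1]), (4, [0, 1]),
    (4, [2, 1]), (4, [3, 1]), (5, [0, 1]), (5, [4, 1]), (6, [0, 1]), (2, [0, 0, 1]),
    (2, [0, 1, 1]), (2, [1, 0, 1]), (2, [1, 1, 1]), (3, [0, 0, 1]), (3, [0, 1, 1]),
    (4, [0, 0, 1]), (4, [3, 1, 3]), (5, [0, 1, 3]), (5, [4, 1, 1]), (6, [0, 0, 1]),
    (6, [0, 0, 2]), (6, [0, 1, 4]), (2, [0, 0, 0, 1]), (2, [0, 1, 0, 1]), (2, [1, 1, 1, 1]),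
    (3, [0, 0, 0, 1]), (3, [2, 1, 2, 1]), (4, [0, 0, 0, 1]), (5, [0, 0, 0, 1]),
    (2, [0, 0, 0, 0, 1]), (2, [1, 1, 1, 1, 1]), (5, [0, 0, 0, 0, 1]), (2, [0, 0, 0, 0, 0, 1])]

theorem exists_separatesWeights :
    ∀ r ∈ Finset.range 6, ∀ p ∈ exponentTable r,
      ∃ q ∈ separatingPolynomials, SeparatesWeights r p.1 p.2 q.1 q.2 := by
  decide +kernel

theorem exists_omitsLast :
    ∀ r ∈ Finset.range 6, ∀ p ∈ exponentTable r,
      ∃ a ∈ Finset.range 3, ∃ b ∈ Finset.range 6, OmitsLast r p.1 p.2 a b := by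
  decide +kernel

/-- Arity 0 is covered although its table is empty, since both weight sets are trivial. -/
theorem exponentTable_complete :
    ∀ r ∈ Finset.range 6, ∀ W ∈ (Finset.range (r + 1)).powerset,
      W = ∅ ∨ W = Finset.range (r + 1) ∨
      (∃ p ∈ exponentTable r, p.1 = W ∨ p.1 = W.image fun w => r - w) ∨
      r = 5 ∧ ∃ V ∈ [{0, 2, 3}, {1, 2, 4}], V = W ∨ V = W.image fun w => r - w := by
  decide +kernel

theorem IsSymmetric.exists_isTableExponent {r : ℕ} (hr : r ≤ 5) {R : Set (Fin r → Bool)}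
    (hR : IsSymmetric R) (hR' : IsNontrivial R)
    (hex : r = 5 → ∀ V ∈ ([{0, 2, 3}, {1, 2, 4}] : List (Finset ℕ)), ¬ HasWeightsUpToFlip R V) :
    ∃ e, IsTableExponent R e := by
  classical
  let W := (Finset.range (r + 1)).filter (· ∈ acceptedWeights R)
  have hW : acceptedWeights R = W := by
    ext w
    simp only [W, Finset.coe_filter, Finset.mem_range_succ_iff, Set.mem_ofPred_eq]
    refine ⟨fun h => ⟨?_, h⟩, And.right⟩
    obtain ⟨x, -, rfl⟩ := h
    exact hammingWeight_le x
  have hup : ∀ V : Finset ℕ, V = W ∨ V = W.image (fun w => r - w) → HasWeightsUpToFlip R V := by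
    rintro V (rfl | rfl)
    · exact .inl hW
    · exact .inr (by rw [acceptedWeights_bitFlip, hW, Finset.coe_image])
  rcases exponentTable_complete r (by simp; omega) W
    (Finset.mem_powerset.mpr (Finset.filter_subset _ _)) with h | h | ⟨p, hp, h⟩ | ⟨h5, V, hV, h⟩
  · refine absurd ?_ hR'.1
    rw [h, Finset.coe_empty] at hW
    exact Set.image_eq_empty.mp hW
  · refine absurd (Set.eq_univ_of_forall fun x => ?_) hR'.2
    rw [hR.mem_iff, hW, h, Finset.mem_coe, Finset.mem_range_succ_iff]
    exact hammingWeight_le x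
  · exact ⟨p.2, p.1, hp, hup _ h⟩
  · exact absurd (hup V h) (hex h5 V hV)

theorem IsTableExponent.isTheta {U : Finset (Bool → Bool)} (hU : id ∈ U) {r : ℕ} (hr : r ≤ 5)
    {R : Set (Fin r → Bool)} (hR : IsSymmetric R) {e : ℕ} (he : IsTableExponent R e) :
    (fun n : ℕ => (NRD U R n : ℝ)) =Θ[atTop] fun n : ℕ => (n : ℝ) ^ e := by
  obtain ⟨W, hWe, hW⟩ := he
  have hr' : r ∈ Finset.range 6 := Finset.mem_range_succ_iff.mpr hr
  obtain ⟨q, -, hq⟩ := exists_separatesWeights r hr' _ hWe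
  obtain ⟨a, -, b, -, hab⟩ := exists_omitsLast r hr' _ hWe
  exact ⟨hq.isBigO hR hW, hab.isBigO hU hR hW⟩

/-- Uniqueness of the exponent comes from asymptotics: distinct powers of `n` have distinct growth.
-/
theorem pow_isTheta_injective {d e : ℕ}
    (h : (fun n : ℕ => (n : ℝ) ^ d) =Θ[atTop] fun n : ℕ => (n : ℝ) ^ e) : d = e := by
  have key : ∀ a b : ℕ, (fun n : ℕ => (n : ℝ) ^ a) =O[atTop] (fun n : ℕ => (n : ℝ) ^ b) →
      a ≤ b := by
    intro a b hab
    by_contra! hlt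
    have ho : (fun n : ℕ => (n : ℝ) ^ b) =o[atTop] fun n : ℕ => (n : ℝ) ^ a :=
      (isLittleO_pow_pow_atTop_of_lt (𝕜 := ℝ) hlt).comp_tendsto tendsto_natCast_atTop_atTop
    have := ho.trans_isBigO hab
    refine (isLittleO_irrefl (Eventually.frequently ?_)) this
    filter_upwards [eventually_gt_atTop 0] with n hn
    positivity
  exact le_antisymm (key _ _ h.1) (key _ _ h.2)

theorem IsSymmetric.existsUnique_exponent {U : Finset (Bool → Bool)} (hU : id ∈ U) {r : ℕ}
    (hr : r ≤ 5) {R : Set (Fin r → Bool)} (hR : IsSymmetric R) (hR' : IsNontrivial R)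
    (hex : r = 5 → ∀ V ∈ ([{0, 2, 3}, {1, 2, 4}] : List (Finset ℕ)), ¬ HasWeightsUpToFlip R V) :
    ∃! e : ℕ, IsTableExponent R e ∧
      (fun n : ℕ => (NRD U R n : ℝ)) =Θ[atTop] (fun n : ℕ => (n : ℝ) ^ e) := by
  obtain ⟨e, he⟩ := hR.exists_isTableExponent hr hR' hex
  have hθ := he.isTheta hU hr hR
  exact ⟨e, ⟨he, hθ⟩, fun d hd => pow_isTheta_injective (hd.2.symm.trans hθ)⟩

end BoolCSP

theorem mainTheorem1 (U : Finset (Bool → Bool)) (hU : id ∈ U) :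
    (∀ r : ℕ, r ≤ 4 → ∀ R : Set (Fin r → Bool),
      BoolCSP.IsSymmetric R → BoolCSP.IsNontrivial R →
        ∃! e : ℕ, BoolCSP.IsTableExponent R e ∧
          (fun n : ℕ => (BoolCSP.NRD U R n : ℝ)) =Θ[atTop] (fun n : ℕ => (n : ℝ) ^ e)) ∧
    (∀ R : Set (Fin 5 → Bool),
      BoolCSP.IsSymmetric R → BoolCSP.IsNontrivial R → ¬ BoolCSP.IsExceptional R →
        ∃! e : ℕ, BoolCSP.IsTableExponent R e ∧
          (fun n : ℕ => (BoolCSP.NRD U R n : ℝ)) =Θ[atTop] (fun n : ℕ => (n : ℝ) ^ e)) ∧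
    (∀ R : Set (Fin 5 → Bool),
      BoolCSP.IsSymmetric R → BoolCSP.IsExceptional R →
        (fun n : ℕ => (n : ℝ) ^ 2) =O[atTop] (fun n : ℕ => (BoolCSP.NRD U R n : ℝ)) ∧
          (fun n : ℕ => (BoolCSP.NRD U R n : ℝ)) =O[atTop] (fun n : ℕ => (n : ℝ) ^ 3)) := by
  refine ⟨fun r hr R hR hR' => hR.existsUnique_exponent hU (by omega) hR' (by omega),
    fun R hR hR' hex => hR.existsUnique_exponent hU le_rfl hR' fun _ V hV hW => hex ?_,
    fun R hR hex => ?_⟩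
  · simp only [List.mem_cons, List.not_mem_nil, or_false] at hV
    rcases hV with rfl | rfl
    · exact .inl hW
    · exact .inr hW
  · rcases hex with hW | hW
    -- Weights 2, 3 are accepted and 4 rejected. The cubic takes the values 0, 1, 0, 0, 4, 3 modulo
    -- 6 on weights 0 to 5.
    · have hlow : BoolCSP.OmitsLast 5 {0, 2, 3} 2 1 2 := by decide
      have hupp : BoolCSP.SeparatesWeights 5 {0, 2, 3} 3 6 [0, 1, 4, 3] := by decide +kernel
      exact ⟨hlow.isBigO hU hR hW, hupp.isBigO hR hW⟩
    -- Weights 1, 2 are accepted and 3 rejected. The cubic takes the values 4, 0, 0, 1, 0, 4 modulo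
    -- 5.
    · have hlow : BoolCSP.OmitsLast 5 {1, 2, 4} 2 1 1 := by decide
      have hupp : BoolCSP.SeparatesWeights 5 {1, 2, 4} 3 5 [4, 1, 4, 2] := by decide +kernel
      exact ⟨hlow.isBigO hU hR hW, hupp.isBigO hR hW⟩
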